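/- Let $\Omega\subset\mathbb{R}^2$ be a non-empty, bounded, strictly convex open set whose boundary $\partial\Omega$ is a real-analytic closed curve, and let $\gamma:\mathbb{R}/L\mathbb{Z}\to\partial\Omega$ be a unit-speed real-analytic simple parametrization of it. For $c\in\Omega$ and $\xi\in\mathbb{R}/L\mathbb{Z}$, let $\gamma(\xi')\in\partial\Omega$ be the point such that the segment from $c$ to $\gamma(\xi)$ is elastically reflected at $\gamma(\xi)$ (by reflecting its direction about the tangent line of $\partial\Omega$ at $\gamma(\xi)$) into the segment from $\gamma(\xi)$ to $\gamma(\xi')$, and put $$\varphi_c(\xi)=|\gamma(\xi)-c|+|\gamma(\xi)-\gamma(\xi')|+|\gamma(\xi')-c|.$$ The point $c$ is called a focal point of $\Omega$ if $\varphi_c$ is constant. It is called of the first kind if there are two distinct points of $\partial\Omega$, each of which is a strict local minimum or a strict local maximum of the distance to $c$ along $\partial\Omega$, that are not antipodal with respect to $c$, that is, such that $c$ does not lie on the open segment between them; otherwise $c$ is called of the second kind. Let $p\ge 2$ be an integer. Assume that $\partial\Omega$ is not a circle and that it is invariant under the rotation of angle $2\pi/p$ about some point of the plane. Then $\Omega$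 has no focal point of the second kind, unless $p=2$ and $\partial\Omega$ is an ellipse. -/

import Mathlib

/-- A bounded, strictly convex planar domain; the Euclidean plane is `ℂ`. (For an open set
Mathlib's `StrictConvex` is just convexity; strict convexity, i.e. the absence of segments in the
boundary, is that of the closure.) -/
structure IsStrictlyConvexDomain (Ω : Set ℂ) : Prop where
  isOpen : IsOpen Ω
  nonempty : Ω.Nonempty
  isBounded : Bornology.IsBounded Ω
  convex : Convex ℝ Ω
  strictConvex_closure : StrictConvex ℝ (closure Ω)

/-- `γ` is a real-analytic, unit speed, simple closed parametrization, of period (length) `L`, of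
the boundary of `Ω`; the parameter circle `ℝ / Lℤ` is handled through `L`-periodic functions. -/
structure IsAnalyticBoundaryParam (Ω : Set ℂ) (L : ℝ) (γ : ℝ → ℂ) : Prop where
  length_pos : 0 < L
  analytic : ∀ ξ, AnalyticAt ℝ γ ξ
  periodic : Function.Periodic γ L
  injOn : Set.InjOn γ (Set.Ico 0 L)
  unit_speed : ∀ ξ, ‖deriv γ ξ‖ = 1
  range_eq : Set.range γ = frontier Ω

/-- The parameter `ξ` is a strict local extremum (minimum or maximum) of `|γ(·) - c|`. -/
def IsStrictLocalExtremal (γ : ℝ → ℂ) (c : ℂ) (ξ : ℝ) : Prop :=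
  (∀ᶠ t in nhdsWithin ξ {ξ}ᶜ, dist (γ ξ) c < dist (γ t) c) ∨
    (∀ᶠ t in nhdsWithin ξ {ξ}ᶜ, dist (γ t) c < dist (γ ξ) c)

/-- Two points are antipodal with respect to `c`: they lie on a line through `c`, on opposite
sides of `c`. -/
def Antipodal (c x y : ℂ) : Prop := c ∈ openSegment ℝ x y

/-- `c` is of the first kind: two distinct boundary points that are strict local extremals of the
distance from `c` are not antipodal with respect to `c`. -/
def IsFirstKind (γ : ℝ → ℂ) (c : ℂ) : Prop :=
  ∃ ξ η : ℝ, IsStrictLocalExtremal γ c ξ ∧ IsStrictLocalExtremal γ c η ∧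
    γ ξ ≠ γ η ∧ ¬ Antipodal c (γ ξ) (γ η)

/-- `c` is of the second kind. -/
def IsSecondKind (γ : ℝ → ℂ) (c : ℂ) : Prop := ¬ IsFirstKind γ c

/-- The segment from `c` to `γ ξ` is elastically reflected into the segment from `γ ξ` to `γ η`:
the outgoing direction is that of the incoming vector reflected about the tangent line. -/
def ReflectsInto (γ : ℝ → ℂ) (c : ℂ) (ξ η : ℝ) : Prop :=
  γ η ≠ γ ξ ∧
    SameRay ℝ ((Submodule.span ℝ {deriv γ ξ}).reflection (γ ξ - c)) (γ η - γ ξ)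

/-- `c` is a focal point: the perimeter
`φ_c(ξ) = |γ(ξ) - c| + |γ(ξ) - γ(ξ')| + |γ(ξ') - c|`, where `c γ(ξ)` elastically reflects into
`γ(ξ) γ(ξ')`, is constant in `ξ`. (In a strictly convex table with `c` inside, the point `γ(ξ')`
exists and is unique.) -/
def IsFocalPoint (γ : ℝ → ℂ) (c : ℂ) : Prop :=
  ∃ κ : ℝ, ∀ ξ : ℝ, ∃ ξ' : ℝ, ReflectsInto γ c ξ ξ' ∧
    dist (γ ξ) c + dist (γ ξ) (γ ξ') + dist (γ ξ') c = κ

/-- A circle of positive radius. -/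
def IsCircle (S : Set ℂ) : Prop := ∃ (z : ℂ) (r : ℝ), 0 < r ∧ S = Metric.sphere z r

/-- A (nondegenerate, possibly circular) ellipse with foci `F₁`, `F₂` and semi-major axis `a`. -/
def IsEllipse (S : Set ℂ) : Prop :=
  ∃ (F₁ F₂ : ℂ) (a : ℝ), dist F₁ F₂ < 2 * a ∧ S = {z | dist z F₁ + dist z F₂ = 2 * a}

/-- The rotation of the plane of angle `θ` about `z₀`. -/
noncomputable def rotationAbout (z₀ : ℂ) (θ : ℝ) (z : ℂ) : ℂ :=
  z₀ + Complex.exp (θ * Complex.I) * (z - z₀)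

/-- `S` is invariant under the rotation of angle `2π/p` about some point of the plane. -/
def HasCyclicSymmetry (S : Set ℂ) (p : ℕ) : Prop :=
  ∃ z₀ : ℂ, rotationAbout z₀ (2 * Real.pi / p) '' S = S

open ComplexConjugate

/-! Let `R` be the rotation, with centre z₀, and c a focal point of the second kind. If c = z₀, take
a nearest boundary point m and a farthest one P. Both P and RP are strict extremals (by analyticity)
that must be antipodal to m, so they lie on one ray from c, which is impossible.

If c ≠ z₀, then c' = Rc is another focal point. Put E(P) = |P - c| + |P - c'|. At an extremum P of E
the tangent condition is the reflection law, so the chord PQ issued from c passes through c' and its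
perimeter is E(P) + E(Q). Since this is constant, such chords exchange maxima and minima of E
(`exists_chord_of_isMaxOn_isMinOn`). A chord through c' followed by one through c maps maxima to
maxima and increases the angle seen from c with c' - c, so a maximum of least cosine lies on the
line cc' (`exists_isMaxOn_on_line`).

For p ≥ 3, rotating this maximum A by `R` or its inverse increases E, a contradiction. For p = 2,
the chord from A through c' ends at RA, a minimum with the same value of E; so E is constant and the
boundary is an ellipse. -/

/-! ### Segments and rays in a strictly convex domain. -/

theorem IsStrictlyConvexDomain.interior_closure {Ω : Set ℂ} (hΩ : IsStrictlyConvexDomain Ω) :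
    interior (closure Ω) = Ω := by
  rw [hΩ.convex.interior_closure_eq_interior_of_nonempty_interior, hΩ.isOpen.interior_eq]
  rw [hΩ.isOpen.interior_eq]
  exact hΩ.nonempty

theorem IsStrictlyConvexDomain.notMem_of_mem_frontier {Ω : Set ℂ}
    (hΩ : IsStrictlyConvexDomain Ω) {P : ℂ} (hP : P ∈ frontier Ω) : P ∉ Ω := by
  rw [hΩ.isOpen.frontier_eq] at hP
  exact hP.2

theorem IsStrictlyConvexDomain.openSegment_subset {Ω : Set ℂ} (hΩ : IsStrictlyConvexDomain Ω)
    {P Q : ℂ} (hP : P ∈ frontier Ω) (hQ : Q ∈ frontier Ω) (hPQ : P ≠ Q) :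
    openSegment ℝ P Q ⊆ Ω := by
  rw [← hΩ.interior_closure]
  exact hΩ.strictConvex_closure.openSegment_subset (frontier_subset_closure hP)
    (frontier_subset_closure hQ) hPQ

theorem IsStrictlyConvexDomain.openSegment_subset_of_mem {Ω : Set ℂ}
    (hΩ : IsStrictlyConvexDomain Ω) {c P : ℂ} (hc : c ∈ Ω) (hP : P ∈ frontier Ω) :
    openSegment ℝ c P ⊆ Ω := by
  have h := hΩ.convex.openSegment_interior_closure_subset_interior
    (x := c) (y := P) (by rwa [hΩ.isOpen.interior_eq]) (frontier_subset_closure hP)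
  rwa [hΩ.isOpen.interior_eq] at h

theorem IsStrictlyConvexDomain.isCompact_frontier {Ω : Set ℂ} (hΩ : IsStrictlyConvexDomain Ω) :
    IsCompact (frontier Ω) :=
  Metric.isCompact_of_isClosed_isBounded isClosed_frontier
    (hΩ.isBounded.closure.subset frontier_subset_closure)

/-- Every ray from an interior point meets the boundary. -/
theorem IsStrictlyConvexDomain.exists_ray_mem_frontier {Ω : Set ℂ}
    (hΩ : IsStrictlyConvexDomain Ω) {c v : ℂ} (hc : c ∈ Ω) (hv : v ≠ 0) :
    ∃ t : ℝ, 0 < t ∧ c + t * v ∈ frontier Ω := by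
  by_contra! hcon
  have hf : Continuous fun t : ℝ => c + t * v := by fun_prop
  -- A ray missing the boundary would be split by `Ω` and the exterior; it starts in `Ω` and leaves
  -- it by boundedness.
  have hpre : IsPreconnected ((fun t : ℝ => c + t * v) '' Set.Ici 0) :=
    isPreconnected_Ici.image _ hf.continuousOn
  obtain ⟨R, hR⟩ := hΩ.isBounded.closure.subset_ball c
  have hvn : 0 < ‖v‖ := norm_pos_iff.2 hv
  obtain ⟨z, -, hz1, hz2⟩ := hpre Ω (closure Ω)ᶜ hΩ.isOpen isClosed_closure.isOpen_compl
    (by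
      rintro _ ⟨t, ht, rfl⟩
      rcases (Set.mem_Ici.1 ht).eq_or_lt with h0 | h0
      · left
        simpa [← h0] using hc
      · by_cases h : c + t * v ∈ Ω
        · exact Or.inl h
        · right
          intro h'
          exact hcon t h0 (by rw [hΩ.isOpen.frontier_eq]; exact ⟨h', h⟩))
    ⟨c, ⟨0, by simp, by simp⟩, hc⟩
    ⟨c + (|R| / ‖v‖ : ℝ) * v, ⟨_, Set.mem_Ici.2 (by positivity), rfl⟩, by
      intro h
      have h1 := hR h
      rw [Metric.mem_ball, dist_eq_norm, add_sub_cancel_left, norm_mul, Complex.norm_real,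
        Real.norm_of_nonneg (by positivity), div_mul_cancel₀ _ hvn.ne'] at h1
      exact absurd (le_abs_self R) (not_le.2 h1)⟩
  exact hz2 (subset_closure hz1)

theorem IsStrictlyConvexDomain.frontier_nonempty {Ω : Set ℂ} (hΩ : IsStrictlyConvexDomain Ω) :
    (frontier Ω).Nonempty := by
  obtain ⟨c, hc⟩ := hΩ.nonempty
  obtain ⟨t, -, ht⟩ := hΩ.exists_ray_mem_frontier hc one_ne_zero
  exact ⟨_, ht⟩

/-- A chord leaving `P` in the direction of an interior point passes through that point. -/
theorem IsStrictlyConvexDomain.mem_openSegment_of_sameRay {Ω : Set ℂ}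
    (hΩ : IsStrictlyConvexDomain Ω) {c P Q : ℂ} (hc : c ∈ Ω) (hP : P ∈ frontier Ω)
    (hQ : Q ∈ frontier Ω) (hPQ : Q ≠ P) (h : SameRay ℝ (c - P) (Q - P)) :
    c ∈ openSegment ℝ P Q := by
  have hcP : c ≠ P := fun e => hΩ.notMem_of_mem_frontier hP (e ▸ hc)
  obtain ⟨r, s, hr, hs, e⟩ := h.exists_pos (sub_ne_zero.2 hcP) (sub_ne_zero.2 hPQ)
  simp only [Complex.real_smul] at e
  have hrC : (r : ℂ) ≠ 0 := by exact_mod_cast hr.ne'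
  have hsC : (s : ℂ) ≠ 0 := by exact_mod_cast hs.ne'
  -- Here c divides PQ in ratio s / r. If s > r, then Q lies between P and c, hence in `Ω`.
  rcases lt_trichotomy s r with hlt | heq | hlt
  · refine ⟨1 - s / r, s / r, by rw [sub_pos, div_lt_one hr]; exact hlt, by positivity, by ring, ?_⟩
    simp only [Complex.real_smul]
    push_cast
    field_simp
    linear_combination -e
  · subst heq
    have : c = Q := by
      have := mul_left_cancel₀ hrC e
      linear_combination this
    exact absurd (this ▸ hc) (hΩ.notMem_of_mem_frontier hQ)
  · refine absurd (hΩ.openSegment_subset_of_mem hc hP ?_) (hΩ.notMem_of_mem_frontier hQ)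
    refine ⟨r / s, 1 - r / s, by positivity, by rw [sub_pos, div_lt_one hs]; exact hlt, by ring, ?_⟩
    simp only [Complex.real_smul]
    push_cast
    field_simp
    linear_combination e

/-! ### Recognizing ellipses and circles. -/

theorem dist_lt_dist_add_dist {Ω : Set ℂ} (hΩ : IsStrictlyConvexDomain Ω) {c c' P : ℂ}
    (hc : c ∈ Ω) (hc' : c' ∈ Ω) (hP : P ∈ frontier Ω) : dist c c' < dist P c + dist P c' := by
  rw [dist_comm P c]
  refine lt_of_le_of_ne (dist_triangle _ _ _) fun h => hΩ.notMem_of_mem_frontier hP ?_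
  exact hΩ.convex.segment_subset hc hc' (mem_segment_iff_wbtw.2 (dist_add_dist_eq_iff.1 h.symm))

/-- If the sum of the distances to two interior points is constant on the boundary, the boundary
is an ellipse. -/
theorem IsStrictlyConvexDomain.isEllipse_of_forall_eq {Ω : Set ℂ} (hΩ : IsStrictlyConvexDomain Ω)
    {c c' : ℂ} {M : ℝ} (hc : c ∈ Ω) (hc' : c' ∈ Ω)
    (h : ∀ P ∈ frontier Ω, dist P c + dist P c' = M) : IsEllipse (frontier Ω) := by
  have hlt : dist c c' < M := by
    obtain ⟨P, hP⟩ := hΩ.frontier_nonempty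
    rw [← h P hP]
    exact dist_lt_dist_add_dist hΩ hc hc' hP
  refine ⟨c, c', M / 2, by linarith, Set.Subset.antisymm ?_ ?_⟩
  · intro P hP
    rw [Set.mem_ofPred_eq, h P hP]
    ring
  · intro z hz
    have hz : dist z c + dist z c' = M := by rw [hz.out]; ring
    have hzc : z - c ≠ 0 := by
      rintro e
      rw [sub_eq_zero] at e
      subst e
      rw [dist_self, zero_add] at hz
      exact hlt.ne hz
    obtain ⟨t, ht, hP⟩ := hΩ.exists_ray_mem_frontier hc hzc
    have hE := h _ hP
    -- The sum is convex and is below `M` at c, so shrinking a point of the level set towards c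
    -- makes it drop strictly: each ray from c meets the level set at most once.
    have hconv : ∀ (w : ℂ) (s : ℝ), 0 < s → s < 1 → dist w c + dist w c' = M →
        dist (c + s * (w - c)) c + dist (c + s * (w - c)) c' < M := by
      intro w s hs0 hs1 hw
      have h1 : dist (c + s * (w - c)) c = s * dist w c := by
        rw [dist_eq_norm, dist_eq_norm, add_sub_cancel_left, norm_mul, Complex.norm_real,
          Real.norm_of_nonneg hs0.le]
      have h2 : dist (c + s * (w - c)) c' ≤ s * dist w c' + (1 - s) * dist c c' := by
        rw [dist_eq_norm, dist_eq_norm, dist_eq_norm]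
        have : c + s * (w - c) - c' = (s : ℂ) * (w - c') + ((1 - s : ℝ) : ℂ) * (c - c') := by
          push_cast; ring
        rw [this]
        refine (norm_add_le _ _).trans (le_of_eq ?_)
        rw [norm_mul, norm_mul, Complex.norm_real, Complex.norm_real,
          Real.norm_of_nonneg hs0.le, Real.norm_of_nonneg (by linarith)]
      nlinarith
    rcases lt_trichotomy t 1 with h1 | h1 | h1
    · exact absurd hE (hconv z t ht h1 hz).ne
    · rw [h1] at hP
      simpa using hP
    · have h2 := hconv _ (1 / t) (by positivity) (by rw [div_lt_one ht]; exact h1) hE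
      have htC : (t : ℂ) ≠ 0 := by exact_mod_cast ht.ne'
      have : c + ((1 / t : ℝ) : ℂ) * (c + t * (z - c) - c) = z := by
        push_cast
        field_simp
        ring
      rw [this] at h2
      exact absurd hz h2.ne

/-- If the distance to an interior point is constant on the boundary, the boundary is a circle. -/
theorem IsStrictlyConvexDomain.isCircle_of_forall_eq {Ω : Set ℂ} (hΩ : IsStrictlyConvexDomain Ω)
    {c : ℂ} {r : ℝ} (hc : c ∈ Ω) (h : ∀ P ∈ frontier Ω, dist P c = r) :
    IsCircle (frontier Ω) := by
  have hr : 0 < r := by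
    obtain ⟨P, hP⟩ := hΩ.frontier_nonempty
    rw [← h P hP, dist_pos]
    exact fun e => hΩ.notMem_of_mem_frontier hP (e ▸ hc)
  refine ⟨c, r, hr, Set.Subset.antisymm (fun P hP => h P hP) fun z hz => ?_⟩
  rw [Metric.mem_sphere] at hz
  have hzc : z - c ≠ 0 := by
    rw [sub_ne_zero]
    rintro rfl
    rw [dist_self] at hz
    exact hr.ne hz
  obtain ⟨t, ht, hP⟩ := hΩ.exists_ray_mem_frontier hc hzc
  have hE := h _ hP
  rw [dist_eq_norm, add_sub_cancel_left, norm_mul, Complex.norm_real, Real.norm_of_nonneg ht.le,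
    ← dist_eq_norm, hz] at hE
  have : t = 1 := by
    field_simp at hE
    exact hE
  simpa [this] using hP

/-! ### First variation of distances and the reflection law. -/

theorem hasDerivAt_dist_const {γ : ℝ → ℂ} {τ c : ℂ} {ξ : ℝ} (h : HasDerivAt γ τ ξ)
    (hne : γ ξ ≠ c) :
    HasDerivAt (fun t => dist (γ t) c) ((conj (γ ξ - c) * τ).re / dist (γ ξ) c) ξ := by
  have hpos : 0 < dist (γ ξ) c := dist_pos.2 hne
  have h1 := ((h.sub_const c).norm_sq).sqrt (by simpa [sub_eq_zero] using hne)
  have e : (fun t => dist (γ t) c) = fun t => √(‖γ t - c‖ ^ 2) := by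
    funext t
    rw [Real.sqrt_sq (norm_nonneg _), dist_eq_norm]
  rw [e]
  convert h1 using 1
  rw [Real.sqrt_sq (norm_nonneg _), ← dist_eq_norm, Complex.inner]
  field_simp

/-- The reflection about the line spanned by a unit complex number. -/
theorem reflection_span_eq_mul_conj {τ : ℂ} (hτ : ‖τ‖ = 1) (v : ℂ) :
    (Submodule.span ℝ {τ}).reflection v = τ ^ 2 * conj v := by
  have h1 : τ * conj τ = 1 := by
    rw [Complex.mul_conj, Complex.normSq_eq_norm_sq, hτ]; norm_num
  have h2 : (((conj τ * v).re : ℝ) : ℂ) = (conj τ * v + τ * conj v) / 2 := by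
    rw [Complex.re_eq_add_conj]
    simp
  rw [Submodule.reflection_singleton_apply, hτ]
  have h3 : inner ℝ τ v = (conj τ * v).re := by
    rw [Complex.inner, mul_comm]
  rw [h3]
  simp only [Complex.real_smul, nsmul_eq_mul]
  push_cast
  rw [h2]
  linear_combination v * h1

/-- If the unit tangent `τ` is orthogonal to `u + u'`, for unit vectors `u`, `u'`, then `-u'` is the
reflection of `u` about the tangent, unless `u' = -u`. -/
theorem eq_neg_or_reflection_eq {τ u u' : ℂ} (hτ : ‖τ‖ = 1) (hu : ‖u‖ = 1) (hu' : ‖u'‖ = 1)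
    (h : (conj u * τ).re + (conj u' * τ).re = 0) : u' = -u ∨ τ ^ 2 * conj u = -u' := by
  have hτ1 : τ * conj τ = 1 := by
    rw [Complex.mul_conj, Complex.normSq_eq_norm_sq, hτ]; norm_num
  -- Coordinates relative to the tangent: two unit vectors with opposite real parts have imaginary
  -- parts equal up to sign, whence the two cases.
  set z := conj u * τ with hz
  set z' := conj u' * τ with hz'
  have hzu : u = τ * conj z := by
    simp only [hz, map_mul, Complex.conj_conj]
    linear_combination -u * hτ1
  have hzu' : u' = τ * conj z' := by
    simp only [hz', map_mul, Complex.conj_conj]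
    linear_combination -u' * hτ1
  have hn : z.re ^ 2 + z.im ^ 2 = 1 := by
    have : ‖z‖ ^ 2 = 1 := by rw [hz, norm_mul, Complex.norm_conj, hu, hτ]; norm_num
    rw [← Complex.normSq_eq_norm_sq, Complex.normSq_apply] at this
    linarith
  have hn' : z'.re ^ 2 + z'.im ^ 2 = 1 := by
    have : ‖z'‖ ^ 2 = 1 := by rw [hz', norm_mul, Complex.norm_conj, hu', hτ]; norm_num
    rw [← Complex.normSq_eq_norm_sq, Complex.normSq_apply] at this
    linarith
  have hre : z'.re = -z.re := by linarith
  have him : (z'.im - z.im) * (z'.im + z.im) = 0 := by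
    rw [hre] at hn'
    linear_combination hn' - hn
  rcases mul_eq_zero.1 him with h0 | h0
  · right
    have : conj z' = -z := Complex.ext (by simp [hre]) (by simp; linarith)
    rw [hzu', this, hz]
    ring
  · left
    have : z' = -z := Complex.ext (by simp [hre]) (by simp; linarith)
    rw [hzu', hzu, this]
    simp

theorem ReflectsInto.of_unit {γ : ℝ → ℂ} {c : ℂ} {ξ η : ℝ} (hτ : ‖deriv γ ξ‖ = 1)
    (h : ReflectsInto γ c ξ η) :
    SameRay ℝ (deriv γ ξ ^ 2 * conj (γ ξ - c)) (γ η - γ ξ) := by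
  rw [← reflection_span_eq_mul_conj hτ]
  exact h.2

/-- At an extremum of the sum of the distances to two interior points, the ray coming from the first
point is reflected through the second one. -/
theorem mem_openSegment_of_isExtrOn {Ω : Set ℂ} (hΩ : IsStrictlyConvexDomain Ω) {γ : ℝ → ℂ}
    (hd : ∀ t, DifferentiableAt ℝ γ t) (hu : ∀ t, ‖deriv γ t‖ = 1)
    (hr : Set.range γ = frontier Ω) {c c' : ℂ} (hc : c ∈ Ω) (hc' : c' ∈ Ω) {ξ η : ℝ}
    (href : ReflectsInto γ c ξ η)
    (hex : IsExtrOn (fun P => dist P c + dist P c') (frontier Ω) (γ ξ)) :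
    c' ∈ openSegment ℝ (γ ξ) (γ η) := by
  have hγ : ∀ t, γ t ∈ frontier Ω := fun t => hr ▸ Set.mem_range_self t
  have hne : ∀ {d}, d ∈ Ω → γ ξ ≠ d := fun hd e => hΩ.notMem_of_mem_frontier (hγ ξ) (e ▸ hd)
  have hloc : IsLocalExtr (fun t => dist (γ t) c + dist (γ t) c') ξ := by
    rcases hex with h | h
    · exact Or.inl (Filter.Eventually.of_forall fun t => h (hγ t))
    · exact Or.inr (Filter.Eventually.of_forall fun t => h (hγ t))
  have hder := ((hasDerivAt_dist_const (hd ξ).hasDerivAt (hne hc)).add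
    (hasDerivAt_dist_const (hd ξ).hasDerivAt (hne hc')))
  have h0 := hloc.hasDerivAt_eq_zero hder
  set τ := deriv γ ξ
  set P := γ ξ
  have hp : 0 < dist P c := dist_pos.2 (hne hc)
  have hp' : 0 < dist P c' := dist_pos.2 (hne hc')
  have hpC : ((dist P c : ℝ) : ℂ) ≠ 0 := by exact_mod_cast hp.ne'
  have hpC' : ((dist P c' : ℝ) : ℂ) ≠ 0 := by exact_mod_cast hp'.ne'
  have hunit : ∀ {d}, 0 < dist P d → ‖(P - d) / (dist P d : ℝ)‖ = 1 := by
    intro d hd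
    rw [norm_div, Complex.norm_real, Real.norm_of_nonneg hd.le, dist_eq_norm] at *
    exact div_self hd.ne'
  have hconj : ∀ d, (conj ((P - d) / (dist P d : ℝ)) * τ).re
      = (conj (P - d) * τ).re / dist P d := by
    intro d
    rw [map_div₀, Complex.conj_ofReal, div_mul_eq_mul_div, Complex.div_ofReal_re]
  rcases eq_neg_or_reflection_eq (hu ξ) (hunit hp) (hunit hp')
    (by rw [hconj, hconj]; exact h0) with h | h
  -- Opposite unit vectors would put the boundary point on the segment from c to c', inside `Ω`.
  · exfalso
    have hmem := hΩ.convex hc hc' (a := dist P c' / (dist P c + dist P c'))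
      (b := dist P c / (dist P c + dist P c')) (by positivity) (by positivity)
      (by field_simp; ring)
    refine hΩ.notMem_of_mem_frontier (hγ ξ) ?_
    convert hmem using 1
    have hs : ((dist P c : ℝ) : ℂ) + ((dist P c' : ℝ) : ℂ) ≠ 0 := by
      exact_mod_cast (add_pos hp hp').ne'
    simp only [Complex.real_smul]
    push_cast
    field_simp at h ⊢
    change P * _ = _
    linear_combination h
  · refine hΩ.mem_openSegment_of_sameRay hc' (hγ ξ) (hγ η) href.1 ?_
    have e : τ ^ 2 * conj (P - c) = (dist P c / dist P c') • (c' - P) := by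
      rw [map_div₀, Complex.conj_ofReal] at h
      rw [Complex.real_smul]
      push_cast
      field_simp at h ⊢
      linear_combination h
    have hs := href.of_unit (hu ξ)
    change SameRay ℝ (τ ^ 2 * conj (P - c)) _ at hs
    rw [e] at hs
    have hk : 0 < dist P c / dist P c' := div_pos hp hp'
    have hs' := hs.pos_smul_left (inv_pos.2 hk)
    rwa [inv_smul_smul₀ hk.ne'] at hs'

/-! ### Chords through two focal points. -/

/-- Moving a vector towards another one decreases the angle between them. -/
theorem inner_mul_norm_lt {Y w : ℂ} {β : ℝ} (hβ : 0 < β) (hYw : (Y * conj w).im ≠ 0) :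
    (Y * conj w).re * ‖Y + β * w‖ < ((Y + β * w) * conj w).re * ‖Y‖ := by
  have hY : Y ≠ 0 := by rintro rfl; simp at hYw
  have hw : w ≠ 0 := by rintro rfl; simp at hYw
  have hY0 : 0 < ‖Y‖ := norm_pos_iff.2 hY
  have hw0 : 0 < ‖w‖ ^ 2 := by have := norm_pos_iff.2 hw; positivity
  have hS0 : 0 ≤ ‖Y + β * w‖ := norm_nonneg _
  have hww : w * conj w = ((‖w‖ ^ 2 : ℝ) : ℂ) := by
    rw [Complex.mul_conj, Complex.normSq_eq_norm_sq]
  have hre : ((Y + β * w) * conj w).re = (Y * conj w).re + β * ‖w‖ ^ 2 := by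
    rw [add_mul, mul_assoc, hww, Complex.add_re, ← Complex.ofReal_mul, Complex.ofReal_re]
  have hS : ‖Y + β * w‖ ^ 2 = ‖Y‖ ^ 2 + 2 * β * (Y * conj w).re + β ^ 2 * ‖w‖ ^ 2 := by
    simp only [← Complex.normSq_eq_norm_sq, Complex.normSq_apply]
    simp
    ring
  have hq : (Y * conj w).re ^ 2 + (Y * conj w).im ^ 2 = ‖Y‖ ^ 2 * ‖w‖ ^ 2 := by
    simp only [← Complex.normSq_eq_norm_sq, Complex.normSq_apply]
    simp
    ring
  rw [hre]
  set q := (Y * conj w).re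
  set s := (Y * conj w).im
  set y := ‖Y‖
  set S := ‖Y + β * w‖
  set W := ‖w‖ ^ 2
  have hs2 : 0 < s ^ 2 := by positivity
  have key : (q + β * W) ^ 2 * y ^ 2 - q ^ 2 * S ^ 2 = s ^ 2 * β * (2 * q + β * W) := by
    rw [hS]
    linear_combination (-β * (2 * q + β * W)) * hq
  have hβW : 0 < β * W := mul_pos hβ hw0
  -- The squares are compared by `key`; the cases are both sides positive, sides separated by 0, and
  -- both sides nonpositive.
  rcases lt_or_ge 0 q with h | h
  · refine lt_of_pow_lt_pow_left₀ 2 (by positivity) ?_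
    have : 0 < s ^ 2 * β * (2 * q + β * W) := by positivity
    nlinarith
  · rcases lt_or_ge 0 (q + β * W) with h1 | h1
    · have h2 : q * S ≤ 0 := mul_nonpos_of_nonpos_of_nonneg h hS0
      have h3 : 0 < (q + β * W) * y := mul_pos h1 hY0
      linarith
    · have h2 : 0 < s ^ 2 * β * (-(2 * q + β * W)) := mul_pos (by positivity) (by linarith)
      have h3 : -((q + β * W) * y) < -(q * S) := by
        refine lt_of_pow_lt_pow_left₀ 2 ?_ ?_
        · rw [← neg_mul]; exact mul_nonneg (by linarith) hS0
        · nlinarith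
      linarith

/-- Removes the parametrization, so that two focal points given with different parametrizations of
one boundary can be compared. -/
theorem IsFocalPoint.exists_chord {Ω : Set ℂ} (hΩ : IsStrictlyConvexDomain Ω) {γ : ℝ → ℂ}
    (hd : ∀ t, DifferentiableAt ℝ γ t) (hu : ∀ t, ‖deriv γ t‖ = 1)
    (hr : Set.range γ = frontier Ω) {c c' : ℂ} (hc : c ∈ Ω) (hc' : c' ∈ Ω)
    (hf : IsFocalPoint γ c) :
    ∃ κ : ℝ, ∀ P ∈ frontier Ω, ∃ Q ∈ frontier Ω, dist P c + dist P Q + dist Q c = κ ∧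
      (IsExtrOn (fun P => dist P c + dist P c') (frontier Ω) P → c' ∈ openSegment ℝ P Q) := by
  obtain ⟨κ, hκ⟩ := hf
  refine ⟨κ, fun P hP => ?_⟩
  rw [← hr] at hP
  obtain ⟨ξ, rfl⟩ := hP
  obtain ⟨η, href, hsum⟩ := hκ ξ
  exact ⟨γ η, hr ▸ Set.mem_range_self η, hsum,
    mem_openSegment_of_isExtrOn hΩ hd hu hr hc hc' href⟩

/-- If the chords with constant perimeter pass through `c'` at the extrema of the sum of the
distances to `c` and `c'`, they exchange the maxima and the minima of that sum. -/
theorem exists_chord_of_isMaxOn_isMinOn {S : Set ℂ} (hS : IsCompact S) (hne : S.Nonempty)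
    {c c' : ℂ} {κ : ℝ}
    (h : ∀ P ∈ S, ∃ Q ∈ S, dist P c + dist P Q + dist Q c = κ ∧
      (IsExtrOn (fun P => dist P c + dist P c') S P → c' ∈ openSegment ℝ P Q)) :
    (∀ P ∈ S, IsMaxOn (fun P => dist P c + dist P c') S P →
      ∃ Q ∈ S, IsMinOn (fun P => dist P c + dist P c') S Q ∧ c' ∈ openSegment ℝ P Q) ∧
    (∀ P ∈ S, IsMinOn (fun P => dist P c + dist P c') S P →
      ∃ Q ∈ S, IsMaxOn (fun P => dist P c + dist P c') S Q ∧ c' ∈ openSegment ℝ P Q) := by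
  set E : ℂ → ℝ := fun P => dist P c + dist P c' with hE
  have hEc : Continuous E := by fun_prop
  have hsum : ∀ P ∈ S, IsExtrOn E S P → ∃ Q ∈ S, E P + E Q = κ ∧ c' ∈ openSegment ℝ P Q := by
    intro P hP hex
    obtain ⟨Q, hQ, hκ, hmem⟩ := h P hP
    have hm := hmem hex
    refine ⟨Q, hQ, ?_, hm⟩
    have := dist_add_dist_of_mem_segment (openSegment_subset_segment ℝ P Q hm)
    rw [dist_comm c' Q] at this
    simp only [hE]
    linarith
  obtain ⟨P₁, hP₁, hmax⟩ := hS.exists_isMaxOn hne hEc.continuousOn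
  obtain ⟨P₀, hP₀, hmin⟩ := hS.exists_isMinOn hne hEc.continuousOn
  obtain ⟨Q₁, hQ₁, h₁, -⟩ := hsum P₁ hP₁ hmax.isExtr
  obtain ⟨Q₀, hQ₀, h₀, -⟩ := hsum P₀ hP₀ hmin.isExtr
  -- The partner of a maximum has value at least the minimum, that of a minimum at most the maximum;
  -- both bounds together force equality.
  have hκ : E P₁ + E P₀ = κ := by
    have a : E P₀ ≤ E Q₁ := hmin hQ₁
    have b : E Q₀ ≤ E P₁ := hmax hQ₀
    linarith
  constructor
  · intro P hP hPmax
    obtain ⟨Q, hQ, hs, hm⟩ := hsum P hP hPmax.isExtr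
    refine ⟨Q, hQ, fun R hR => ?_, hm⟩
    have a : E P₁ ≤ E P := hPmax hP₁
    have b : E P₀ ≤ E R := hmin hR
    change E Q ≤ E R
    linarith
  · intro P hP hPmin
    obtain ⟨Q, hQ, hs, hm⟩ := hsum P hP hPmin.isExtr
    refine ⟨Q, hQ, fun R hR => ?_, hm⟩
    have a : E P ≤ E P₀ := hPmin hP₀
    have b : E R ≤ E P₁ := hmax hR
    change E R ≤ E Q
    linarith

/-- Two successive chords, through `c'` and through `c`. -/
theorem exists_sub_eq_of_mem_openSegment {c c' P Q P' : ℂ} (h : c' ∈ openSegment ℝ P Q)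
    (h' : c ∈ openSegment ℝ Q P') :
    ∃ α β : ℝ, 0 < α ∧ 0 < β ∧ α * (P - c) = (P' - c) + β * (c' - c) := by
  obtain ⟨a, b, ha, hb, hab, rfl⟩ := h
  obtain ⟨x, y, hx, hy, hxy, rfl⟩ := h'
  -- Obtained by eliminating Q from aP + bQ = c' and xQ + yP' = c.
  refine ⟨x * a / (y * b), x / (y * b), by positivity, by positivity, ?_⟩
  have hb' : (b : ℂ) ≠ 0 := by exact_mod_cast hb.ne'
  have hy' : (y : ℂ) ≠ 0 := by exact_mod_cast hy.ne'
  have hab' : (a : ℂ) = 1 - b := by rw [← Complex.ofReal_one, ← hab]; push_cast; ring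
  have hxy' : (x : ℂ) = 1 - y := by rw [← Complex.ofReal_one, ← hxy]; push_cast; ring
  simp only [Complex.real_smul]
  push_cast
  rw [hab', hxy']
  field_simp
  ring

/-- A compact set that is stable under following a chord through `c'` and then a chord through `c`
contains a point of the line through `c` and `c'`. -/
theorem exists_mem_im_eq_zero {K : Set ℂ} (hK : IsCompact K) (hne : K.Nonempty) {c c' : ℂ}
    (hc : c ∉ K)
    (h : ∀ P ∈ K, ∃ Q, c' ∈ openSegment ℝ P Q ∧ ∃ P' ∈ K, c ∈ openSegment ℝ Q P') :
    ∃ A ∈ K, ((A - c) * conj (c' - c)).im = 0 := by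
  have hpos : ∀ P ∈ K, 0 < ‖P - c‖ := fun P hP =>
    norm_pos_iff.2 (sub_ne_zero.2 fun e => hc (e ▸ hP))
  have hcont : ContinuousOn (fun P => ((P - c) * conj (c' - c)).re / ‖P - c‖) K := by
    refine ContinuousOn.div ?_ ?_ fun P hP => (hpos P hP).ne'
    · exact (Complex.continuous_re.comp (by fun_prop)).continuousOn
    · fun_prop
  -- Up to a constant factor, this minimizes the cosine of the angle from c' - c. Off the line, P -
  -- c is P' - c turned towards c' - c, so P' would have a smaller cosine.
  obtain ⟨P, hP, hmin⟩ := hK.exists_isMinOn hne hcont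
  refine ⟨P, hP, ?_⟩
  by_contra him
  obtain ⟨Q, hQ, P', hP', hQ'⟩ := h P hP
  obtain ⟨α, β, hα, hβ, e⟩ := exists_sub_eq_of_mem_openSegment hQ hQ'
  have hle : ((P - c) * conj (c' - c)).re / ‖P - c‖ ≤ ((P' - c) * conj (c' - c)).re / ‖P' - c‖ :=
    hmin hP'
  rw [div_le_div_iff₀ (hpos P hP) (hpos P' hP')] at hle
  have him' : ((P' - c) * conj (c' - c)).im ≠ 0 := by
    have e1 : (P' - c) * conj (c' - c)
        = α * ((P - c) * conj (c' - c)) - ((β * ‖c' - c‖ ^ 2 : ℝ) : ℂ) := by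
      have hww : (c' - c) * conj (c' - c) = ((‖c' - c‖ ^ 2 : ℝ) : ℂ) := by
        rw [Complex.mul_conj, Complex.normSq_eq_norm_sq]
      push_cast at hww ⊢
      linear_combination (-conj (c' - c)) * e - β * hww
    rw [e1, Complex.sub_im, Complex.ofReal_im, Complex.im_ofReal_mul, sub_zero]
    exact mul_ne_zero hα.ne' him
  have hlt := inner_mul_norm_lt hβ him'
  rw [← e, norm_mul, Complex.norm_real, Real.norm_of_nonneg hα.le, mul_assoc (α : ℂ),
    Complex.re_ofReal_mul] at hlt
  nlinarith

theorem exists_eq_add_mul_of_im_eq_zero {c c' A : ℂ} (hcc : c ≠ c')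
    (h : ((A - c) * conj (c' - c)).im = 0) : ∃ t : ℝ, A = c + t * (c' - c) := by
  have hw : c' - c ≠ 0 := sub_ne_zero.2 hcc.symm
  have hw' : conj (c' - c) ≠ 0 := (map_ne_zero _).2 hw
  refine ⟨((A - c) * conj (c' - c)).re / ‖c' - c‖ ^ 2, ?_⟩
  have hz : ((((A - c) * conj (c' - c)).re : ℝ) : ℂ) = (A - c) * conj (c' - c) :=
    Complex.ext (by simp) (by rw [Complex.ofReal_im, h])
  have hww : ((‖c' - c‖ : ℂ)) ^ 2 = (c' - c) * conj (c' - c) := by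
    rw [Complex.mul_conj, Complex.normSq_eq_norm_sq]
    push_cast
    rfl
  rw [Complex.ofReal_div, hz, Complex.ofReal_pow, hww]
  field_simp
  ring

/-- For two distinct focal points, the sum of the distances to them is maximal at a boundary point
`A` of the line through them, and minimal at the other end of the chord through `A`. -/
theorem exists_isMaxOn_on_line {Ω : Set ℂ} (hΩ : IsStrictlyConvexDomain Ω) {γ γ' : ℝ → ℂ}
    (hd : ∀ t, DifferentiableAt ℝ γ t) (hu : ∀ t, ‖deriv γ t‖ = 1)
    (hr : Set.range γ = frontier Ω)
    (hd' : ∀ t, DifferentiableAt ℝ γ' t) (hu' : ∀ t, ‖deriv γ' t‖ = 1)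
    (hr' : Set.range γ' = frontier Ω) {c c' : ℂ} (hc : c ∈ Ω) (hc' : c' ∈ Ω) (hcc : c ≠ c')
    (hf : IsFocalPoint γ c) (hf' : IsFocalPoint γ' c') :
    ∃ A ∈ frontier Ω, IsMaxOn (fun P => dist P c + dist P c') (frontier Ω) A ∧
      (∃ t : ℝ, A = c + t * (c' - c)) ∧
      ∃ B ∈ frontier Ω, IsMinOn (fun P => dist P c + dist P c') (frontier Ω) B ∧
        c' ∈ openSegment ℝ A B := by
  have hS := hΩ.isCompact_frontier
  have hne := hΩ.frontier_nonempty
  obtain ⟨κ, hκ⟩ := hf.exists_chord hΩ hd hu hr hc hc'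
  obtain ⟨κ', hκ'⟩ := hf'.exists_chord hΩ hd' hu' hr' hc' hc
  have h1 := (exists_chord_of_isMaxOn_isMinOn hS hne hκ).1
  have h2 := (exists_chord_of_isMaxOn_isMinOn hS hne hκ').2
  have hcomm : (fun P => dist P c' + dist P c) = fun P => dist P c + dist P c' := by
    funext P
    ring
  rw [hcomm] at h2
  set E : ℂ → ℝ := fun P => dist P c + dist P c' with hE
  have hEc : Continuous E := by fun_prop
  obtain ⟨P, hP, hmax⟩ := hS.exists_isMaxOn hne hEc.continuousOn
  set K : Set ℂ := frontier Ω ∩ E ⁻¹' {E P}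
  have hK : IsCompact K := hS.inter_right (isClosed_singleton.preimage hEc)
  have hKmax : ∀ R ∈ K, IsMaxOn E (frontier Ω) R := by
    intro R hR T hT
    have a : E T ≤ E P := hmax hT
    have b : E R = E P := hR.2
    change E T ≤ E R
    rw [b]
    exact a
  have hmaxK : ∀ R ∈ frontier Ω, IsMaxOn E (frontier Ω) R → R ∈ K := fun R hR h =>
    ⟨hR, le_antisymm (hmax hR) (h hP)⟩
  obtain ⟨A, hA, him⟩ := exists_mem_im_eq_zero hK ⟨P, hP, rfl⟩ (c := c) (c' := c')
    (fun h => hΩ.notMem_of_mem_frontier h.1 hc) (by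
      intro R hR
      obtain ⟨Q, hQ, hQmin, hm⟩ := h1 R hR.1 (hKmax R hR)
      obtain ⟨R', hR', hRmax, hm'⟩ := h2 Q hQ hQmin
      exact ⟨Q, hm, R', hmaxK R' hR' hRmax, hm'⟩)
  exact ⟨A, hA.1, hKmax A hA, exists_eq_add_mul_of_im_eq_zero hcc him, h1 A hA.1 (hKmax A hA)⟩

theorem IsStrictlyConvexDomain.ray_unique {Ω : Set ℂ} (hΩ : IsStrictlyConvexDomain Ω) {c v : ℂ}
    (hc : c ∈ Ω) {s t : ℝ} (hs : 0 < s) (ht : 0 < t) (hP : c + s * v ∈ frontier Ω)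
    (hQ : c + t * v ∈ frontier Ω) : s = t := by
  have key : ∀ {s t : ℝ}, 0 < s → s < t → c + s * v ∈ frontier Ω → c + t * v ∉ frontier Ω := by
    intro s t hs hst hP hQ
    have ht := hs.trans hst
    refine hΩ.notMem_of_mem_frontier hP (hΩ.openSegment_subset_of_mem hc hQ ?_)
    refine ⟨1 - s / t, s / t, by rw [sub_pos, div_lt_one ht]; exact hst, by positivity, by ring, ?_⟩
    have htC : (t : ℂ) ≠ 0 := by exact_mod_cast ht.ne'
    simp only [Complex.real_smul]
    push_cast
    field_simp
    ring
  rcases lt_trichotomy s t with h | h | h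
  · exact absurd hQ (key hs h hP)
  · exact h
  · exact absurd hP (key ht h hQ)

/-! ### Rotations preserving the boundary. -/

/-- A similarity `z ↦ z₀ + ω (z - z₀)` with `‖ω‖ = 1` that preserves the boundary preserves the
domain. -/
theorem IsStrictlyConvexDomain.rotation_mem {Ω : Set ℂ} (hΩ : IsStrictlyConvexDomain Ω)
    {z₀ ω : ℂ} (hω : ω ≠ 0)
    (hR : ∀ P ∈ frontier Ω, z₀ + ω * (P - z₀) ∈ frontier Ω) {c : ℂ} (hc : c ∈ Ω) :
    z₀ + ω * (c - z₀) ∈ Ω := by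
  -- The horizontal chord through c is carried to a chord with boundary endpoints, whose open
  -- segment lies in `Ω`.
  obtain ⟨s, hs, hP⟩ := hΩ.exists_ray_mem_frontier hc one_ne_zero
  obtain ⟨t, ht, hQ⟩ := hΩ.exists_ray_mem_frontier hc (v := -1) (by simp)
  have hst : ((s + t : ℝ) : ℂ) ≠ 0 := by exact_mod_cast (add_pos hs ht).ne'
  refine hΩ.openSegment_subset (hR _ hP) (hR _ hQ) ?_ ⟨t / (s + t), s / (s + t), by positivity,
    by positivity, by field_simp; ring, ?_⟩
  · intro e
    have := mul_left_cancel₀ hω (add_left_cancel e)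
    apply hst
    push_cast
    linear_combination this
  · simp only [Complex.real_smul]
    push_cast at hst ⊢
    field_simp
    ring

theorem deriv_rotation {γ : ℝ → ℂ} (hd : ∀ t, DifferentiableAt ℝ γ t) (z₀ ω : ℂ) (ξ : ℝ) :
    HasDerivAt (fun t => z₀ + ω * (γ t - z₀)) (ω * deriv γ ξ) ξ :=
  (((hd ξ).hasDerivAt.sub_const z₀).const_mul ω).const_add z₀

theorem dist_rotation {z₀ ω : ℂ} (hω : ‖ω‖ = 1) (z w : ℂ) :
    dist (z₀ + ω * (z - z₀)) (z₀ + ω * (w - z₀)) = dist z w := by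
  rw [dist_eq_norm, dist_eq_norm, show z₀ + ω * (z - z₀) - (z₀ + ω * (w - z₀)) = ω * (z - w) by
    ring, norm_mul, hω, one_mul]

/-- A rotation maps focal points to focal points. -/
theorem IsFocalPoint.rotation {γ : ℝ → ℂ} (hd : ∀ t, DifferentiableAt ℝ γ t)
    (hu : ∀ t, ‖deriv γ t‖ = 1) {z₀ ω c : ℂ} (hω : ‖ω‖ = 1) (hf : IsFocalPoint γ c) :
    IsFocalPoint (fun t => z₀ + ω * (γ t - z₀)) (z₀ + ω * (c - z₀)) := by
  obtain ⟨κ, hκ⟩ := hf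
  refine ⟨κ, fun ξ => ?_⟩
  obtain ⟨η, href, hsum⟩ := hκ ξ
  have hω0 : ω ≠ 0 := by rintro rfl; simp at hω
  have hωω : ω * conj ω = 1 := by
    rw [Complex.mul_conj, Complex.normSq_eq_norm_sq, hω]; norm_num
  refine ⟨η, ⟨?_, ?_⟩, ?_⟩
  · intro e
    exact href.1 (by simpa using mul_left_cancel₀ hω0 (add_left_cancel e))
  · have hder := (deriv_rotation hd z₀ ω ξ).deriv
    rw [reflection_span_eq_mul_conj (by rw [hder, norm_mul, hω, hu ξ, one_mul]), hder]
    have h := (href.of_unit (hu ξ)).map (LinearMap.mulLeft ℝ ω)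
    simp only [LinearMap.mulLeft_apply] at h
    have hdiff : ∀ z w : ℂ, z₀ + ω * (z - z₀) - (z₀ + ω * (w - z₀)) = ω * (z - w) := fun z w => by
      ring
    have hrefl : (ω * deriv γ ξ) ^ 2 * conj (ω * (γ ξ - c))
        = ω * (deriv γ ξ ^ 2 * conj (γ ξ - c)) := by
      rw [map_mul]
      linear_combination (deriv γ ξ ^ 2 * ω * conj (γ ξ - c)) * hωω
    simp only [hdiff]
    rw [hrefl]
    exact h
  · simp only [dist_rotation hω]
    exact hsum

/-- A maximum of the sum of the distances to `c` and to its image under a rotation that is not a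
central symmetry does not lie on the line through these two points. -/
theorem not_isMaxOn_of_rotation {S : Set ℂ} {z₀ ω c A : ℂ} {t : ℝ} (hω : ‖ω‖ = 1)
    (hω1 : ω ≠ 1) (hωre : -1 < ω.re) (hc : c ≠ z₀)
    (hR : (fun z => z₀ + ω * (z - z₀)) '' S = S) (hAS : A ∈ S)
    (hA : A = c + t * (z₀ + ω * (c - z₀) - c)) :
    ¬ IsMaxOn (fun P => dist P c + dist P (z₀ + ω * (c - z₀))) S A := by
  intro hmax
  have hx : 0 < ‖c - z₀‖ := norm_pos_iff.2 (sub_ne_zero.2 hc)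
  have hω1' : 0 < ‖1 - ω‖ := norm_pos_iff.2 (sub_ne_zero.2 hω1.symm)
  have hn : ω.re ^ 2 + ω.im ^ 2 = 1 := by
    have : ‖ω‖ ^ 2 = 1 := by rw [hω]; norm_num
    rw [← Complex.normSq_eq_norm_sq, Complex.normSq_apply] at this
    linarith
  have hlt : ∀ {u v : ℂ}, Complex.normSq u < Complex.normSq v → ‖u‖ < ‖v‖ := by
    intro u v h
    rw [Complex.normSq_eq_norm_sq, Complex.normSq_eq_norm_sq] at h
    exact lt_of_pow_lt_pow_left₀ 2 (norm_nonneg _) h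
  rcases lt_or_ge 0 t with ht | ht
  -- For t > 0 the competitor is RA: |RA - c'| = |A - c|, so only |RA - c| and |A - c'| are
  -- compared.
  · have hRA : z₀ + ω * (A - z₀) ∈ S := hR ▸ Set.mem_image_of_mem _ hAS
    have h : dist (z₀ + ω * (A - z₀)) c + dist (z₀ + ω * (A - z₀)) (z₀ + ω * (c - z₀))
      ≤ dist A c + dist A (z₀ + ω * (c - z₀)) := hmax hRA
    rw [dist_rotation hω] at h
    have h1 : dist (z₀ + ω * (A - z₀)) c = ‖c - z₀‖ * ‖1 - ω‖ * ‖1 + t * ω‖ := by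
      rw [dist_eq_norm, ← norm_mul, ← norm_mul, ← norm_neg, hA]
      congr 1; ring
    have h2 : dist A (z₀ + ω * (c - z₀)) = ‖c - z₀‖ * ‖1 - ω‖ * ‖(1 - t : ℂ)‖ := by
      rw [dist_eq_norm, ← norm_mul, ← norm_mul, hA]
      congr 1; ring
    have h3 : ‖(1 - t : ℂ)‖ < ‖1 + t * ω‖ := by
      apply hlt
      simp only [Complex.normSq_apply]
      simp
      nlinarith
    have h4 := mul_lt_mul_of_pos_left h3 (mul_pos hx hω1')
    linarith
  -- For t ≤ 0 the competitor is the preimage of A, and `1 + ω` has positive real part.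
  · obtain ⟨B, hBS, hB⟩ := hR.symm ▸ hAS
    simp only at hB
    have h : dist B c + dist B (z₀ + ω * (c - z₀))
      ≤ dist A c + dist A (z₀ + ω * (c - z₀)) := hmax hBS
    rw [← dist_rotation hω B c, hB, ← dist_rotation (z₀ := z₀) hω B (z₀ + ω * (c - z₀)), hB] at h
    have h1 : dist A (z₀ + ω * (z₀ + ω * (c - z₀) - z₀))
        = ‖c - z₀‖ * ‖1 - ω‖ * ‖1 + ω - t‖ := by
      rw [dist_eq_norm, ← norm_mul, ← norm_mul, hA]
      congr 1; ring
    have h2 : dist A c = ‖c - z₀‖ * ‖1 - ω‖ * ‖(t : ℂ)‖ := by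
      rw [dist_eq_norm, ← norm_mul, ← norm_mul, ← norm_neg, hA]
      congr 1; ring
    have h3 : ‖(t : ℂ)‖ < ‖1 + ω - t‖ := by
      apply hlt
      simp only [Complex.normSq_apply]
      simp
      nlinarith
    have h4 := mul_lt_mul_of_pos_left h3 (mul_pos hx hω1')
    linarith

/-- If two focal points are exchanged by a central symmetry of the boundary, then the boundary is
an ellipse. -/
theorem isEllipse_of_central_symmetry {Ω : Set ℂ} (hΩ : IsStrictlyConvexDomain Ω)
    {z₀ c A B : ℂ} {t : ℝ} (hc : c ∈ Ω) (hc' : z₀ + (-1) * (c - z₀) ∈ Ω)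
    (hR : ∀ P ∈ frontier Ω, z₀ + (-1) * (P - z₀) ∈ frontier Ω)
    (hA : A ∈ frontier Ω) (hB : B ∈ frontier Ω)
    (hmax : IsMaxOn (fun P => dist P c + dist P (z₀ + (-1) * (c - z₀))) (frontier Ω) A)
    (hmin : IsMinOn (fun P => dist P c + dist P (z₀ + (-1) * (c - z₀))) (frontier Ω) B)
    (hAt : A = c + t * (z₀ + (-1) * (c - z₀) - c))
    (hAB : z₀ + (-1) * (c - z₀) ∈ openSegment ℝ A B) : IsEllipse (frontier Ω) := by
  set c' := z₀ + (-1) * (c - z₀) with hc'def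
  have hAΩ := hΩ.notMem_of_mem_frontier hA
  -- A is not in `Ω`, hence not on the segment from c to c'.
  have ht : 0 < t * (t - 1) := by
    by_contra! hcon
    apply hAΩ
    have h0 : 0 ≤ t := by nlinarith
    have h1 : 0 ≤ 1 - t := by nlinarith
    have := hΩ.convex hc hc' h1 h0 (by ring)
    convert this using 1
    rw [hAt]
    simp only [Complex.real_smul]
    push_cast
    ring
  have ht1 : t - 1 ≠ 0 := by rintro h; simp [h] at ht
  have hpos : 0 < t / (t - 1) := by
    rw [← mul_div_mul_right t (t - 1) ht1]
    exact div_pos ht (mul_self_pos.2 ht1)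
  obtain ⟨a, b, ha, hb, hab, hc''⟩ := hAB
  simp only [Complex.real_smul] at hc''
  have hbC : (b : ℂ) ≠ 0 := by exact_mod_cast hb.ne'
  have htC : (t : ℂ) - 1 ≠ 0 := by exact_mod_cast ht1
  have habC : (a : ℂ) = 1 - b := by rw [← Complex.ofReal_one, ← hab]; push_cast; ring
  have e1 : B = c' + ((a / b : ℝ) : ℂ) * (c' - A) := by
    push_cast
    field_simp
    rw [habC] at hc'' ⊢
    linear_combination hc''
  have e2 : z₀ + (-1) * (A - z₀) = c' + ((t / (t - 1) : ℝ) : ℂ) * (c' - A) := by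
    push_cast
    rw [hAt]
    field_simp
    rw [hc'def]
    ring
  have hRA := hR A hA
  rw [e1] at hB
  rw [e2] at hRA
  -- Both B and the image of A lie on the ray from c' away from A.
  have hEq : B = z₀ + (-1) * (A - z₀) := by
    rw [e1, e2, hΩ.ray_unique hc' (div_pos ha hb) hpos hB hRA]
  have h1 : dist B c' = dist A c := by
    rw [hEq, hc'def]
    exact dist_rotation (by simp) A c
  have h2 : dist B c = dist A c' := by
    rw [hEq, ← dist_rotation (z₀ := z₀) (ω := -1) (by simp) _ c]
    congr 1
    ring
  refine hΩ.isEllipse_of_forall_eq (M := dist A c + dist A c') hc hc' fun P hP =>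
    le_antisymm (hmax hP) ?_
  have h3 : dist B c + dist B c' ≤ dist P c + dist P c' := hmin hP
  rw [h1, h2] at h3
  linarith

/-! ### A focal point at the centre of symmetry. -/

/-- Along an analytic curve on which the distance to `c` is not constant, an extremal value of that
distance is only taken at isolated parameters. -/
theorem eventually_dist_ne {γ : ℝ → ℂ} (hγ : ∀ ξ, AnalyticAt ℝ γ ξ) {c : ℂ} {ξ η : ℝ}
    (h : dist (γ η) c ≠ dist (γ ξ) c) :
    ∀ᶠ t in nhdsWithin ξ {ξ}ᶜ, dist (γ t) c ≠ dist (γ ξ) c := by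
  have hsq : ∀ t, Complex.normSq (γ t - c) = dist (γ t) c ^ 2 := fun t => by
    rw [Complex.normSq_eq_norm_sq, dist_eq_norm]
  -- The squared distance is analytic even where the curve might meet c, so the identity theorem
  -- applies.
  have hf : AnalyticOnNhd ℝ (fun t => Complex.normSq (γ t - c)) Set.univ := by
    intro t _
    have h1 : AnalyticAt ℝ (fun t => γ t - c) t := (hγ t).sub analyticAt_const
    have hre : AnalyticAt ℝ (fun t => (γ t - c).re) t :=
      (Complex.reCLM.analyticAt _).comp h1
    have him : AnalyticAt ℝ (fun t => (γ t - c).im) t :=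
      (Complex.imCLM.analyticAt _).comp h1
    simp only [Complex.normSq_apply]
    exact (hre.mul hre).add (him.mul him)
  by_contra hcon
  rw [← Filter.Frequently] at hcon
  have hfr : ∃ᶠ t in nhdsWithin ξ {ξ}ᶜ,
      Complex.normSq (γ t - c) = (fun _ => Complex.normSq (γ ξ - c)) t :=
    hcon.mono fun t ht => by rw [hsq, hsq, ht]
  have := congrFun (hf.eq_of_frequently_eq (fun _ _ => analyticAt_const) hfr) η
  simp only [hsq] at this
  exact h ((pow_left_inj₀ dist_nonneg dist_nonneg two_ne_zero).1 this)

/-- The centre of a nontrivial rotation preserving a noncircular boundary is of the first kind. -/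
theorem isFirstKind_center {Ω : Set ℂ} (hΩ : IsStrictlyConvexDomain Ω) {γ : ℝ → ℂ}
    (hγ : ∀ ξ, AnalyticAt ℝ γ ξ) (hr : Set.range γ = frontier Ω) {c ω : ℂ} (hc : c ∈ Ω)
    (hω : ‖ω‖ = 1) (hω1 : ω ≠ 1) (hR : ∀ P ∈ frontier Ω, c + ω * (P - c) ∈ frontier Ω)
    (hcircle : ¬ IsCircle (frontier Ω)) : IsFirstKind γ c := by
  by_contra hsecond
  have hcont : ContinuousOn (fun P => dist P c) (frontier Ω) := by fun_prop
  have hγm : ∀ t, γ t ∈ frontier Ω := fun t => hr ▸ Set.mem_range_self t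
  obtain ⟨P, hP, hmax⟩ := hΩ.isCompact_frontier.exists_isMaxOn hΩ.frontier_nonempty hcont
  obtain ⟨m, hm, hmin⟩ := hΩ.isCompact_frontier.exists_isMinOn hΩ.frontier_nonempty hcont
  have hmax : ∀ Q ∈ frontier Ω, dist Q c ≤ dist P c := fun Q hQ => hmax hQ
  have hmin : ∀ Q ∈ frontier Ω, dist m c ≤ dist Q c := fun Q hQ => hmin hQ
  have hne : dist m c ≠ dist P c := fun e =>
    hcircle (hΩ.isCircle_of_forall_eq hc fun Q hQ =>
      le_antisymm (hmax Q hQ) (e ▸ hmin Q hQ))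
  have hRd : dist (c + ω * (P - c)) c = dist P c := by
    rw [dist_eq_norm, add_sub_cancel_left, norm_mul, hω, one_mul, dist_eq_norm]
  obtain ⟨η, rfl⟩ : m ∈ Set.range γ := hr ▸ hm
  have hminE : IsStrictLocalExtremal γ c η := by
    obtain ⟨ξ, rfl⟩ : P ∈ Set.range γ := hr ▸ hP
    left
    filter_upwards [eventually_dist_ne hγ hne.symm] with t ht
    exact lt_of_le_of_ne (hmin _ (hγm t)) ht.symm
  have key : ∀ Q ∈ frontier Ω, dist Q c = dist P c → Antipodal c Q (γ η) := by
    intro Q hQ hQd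
    obtain ⟨ξ, rfl⟩ : Q ∈ Set.range γ := hr ▸ hQ
    by_contra hanti
    refine hsecond ⟨ξ, η, Or.inr ?_, hminE, fun e => hne (by rw [← hQd, e]), hanti⟩
    filter_upwards [eventually_dist_ne hγ (hQd ▸ hne)] with t ht
    exact lt_of_le_of_ne (hQd ▸ hmax _ (hγm t)) ht
  obtain ⟨a, b, ha, hb, hab, h1⟩ := key P hP rfl
  obtain ⟨a', b', ha', hb', hab', h2⟩ := key _ (hR P hP) hRd
  simp only [Complex.real_smul] at h1 h2
  have habC : (a : ℂ) + b = 1 := by exact_mod_cast hab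
  have habC' : (a' : ℂ) + b' = 1 := by exact_mod_cast hab'
  have hPc : P - c ≠ 0 := sub_ne_zero.2 fun e => hΩ.notMem_of_mem_frontier hP (e ▸ hc)
  have h1' : (a : ℂ) * (P - c) = -b * (γ η - c) := by linear_combination h1 - c * habC
  have h2' : (a' : ℂ) * ω * (P - c) = -b' * (γ η - c) := by linear_combination h2 - c * habC'
  -- Eliminating the nearest point shows that `ω` is a positive real, hence 1.
  have h3 : (b * a' : ℝ) * ω = ((b' * a : ℝ) : ℂ) := by
    apply mul_right_cancel₀ hPc
    push_cast
    linear_combination b * h2' - b' * h1'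
  have hpos : 0 < b * a' := mul_pos hb ha'
  have hpos' : 0 < b' * a := mul_pos hb' ha
  have h4 : b * a' = b' * a := by
    have := congrArg norm h3
    rwa [norm_mul, hω, mul_one, Complex.norm_real, Complex.norm_real,
      Real.norm_of_nonneg hpos.le, Real.norm_of_nonneg hpos'.le] at this
  rw [← h4] at h3
  exact hω1 (by
    have : ((b * a' : ℝ) : ℂ) ≠ 0 := by exact_mod_cast hpos.ne'
    exact mul_left_cancel₀ this (by rw [h3, mul_one]))

/-! ### Conclusion. -/

theorem corollary4p2 (Ω : Set ℂ) (L : ℝ) (γ : ℝ → ℂ)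
    (hΩ : IsStrictlyConvexDomain Ω) (hγ : IsAnalyticBoundaryParam Ω L γ)
    (p : ℕ) (hp : 2 ≤ p)
    (hcircle : ¬ IsCircle (frontier Ω))
    (hsymm : HasCyclicSymmetry (frontier Ω) p)
    (hexc : ¬ (p = 2 ∧ IsEllipse (frontier Ω))) :
    ¬ ∃ c ∈ Ω, IsFocalPoint γ c ∧ IsSecondKind γ c := by
  rintro ⟨c, hc, hfocal, hsecond⟩
  obtain ⟨z₀, hR⟩ := hsymm
  have hd : ∀ t, DifferentiableAt ℝ γ t := fun t => (hγ.analytic t).differentiableAt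
  have hp0 : (0 : ℝ) < p := by exact_mod_cast (by omega : 0 < p)
  have hω' : Complex.exp ((2 * Real.pi / p : ℝ) * Complex.I)
      = Complex.exp (2 * Real.pi * Complex.I / p) := by
    congr 1; push_cast; ring
  set θ : ℝ := 2 * Real.pi / p with hθ
  set ω := Complex.exp (θ * Complex.I) with hωdef
  replace hR : (fun z => z₀ + ω * (z - z₀)) '' frontier Ω = frontier Ω := by
    have : (fun z => z₀ + ω * (z - z₀)) = rotationAbout z₀ (2 * Real.pi / p) := by
      funext z
      simp [rotationAbout, hωdef, hθ]
    rw [this]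
    exact hR
  have hRm : ∀ P ∈ frontier Ω, z₀ + ω * (P - z₀) ∈ frontier Ω := fun P hP =>
    hR ▸ Set.mem_image_of_mem _ hP
  have hω : ‖ω‖ = 1 := Complex.norm_exp_ofReal_mul_I θ
  have hωre : ω.re = Real.cos θ := Complex.exp_ofReal_mul_I_re θ
  have hω1 : ω ≠ 1 := by
    rw [hω']
    exact (Complex.isPrimitiveRoot_exp p (by omega)).ne_one (by omega)
  by_cases hcz : c = z₀
  · subst hcz
    exact hsecond (isFirstKind_center hΩ hγ.analytic hγ.range_eq hc hω hω1 hRm hcircle)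
  have hω0 : ω ≠ 0 := Complex.exp_ne_zero _
  have hcc : c ≠ z₀ + ω * (c - z₀) := by
    intro e
    have h : (ω - 1) * (c - z₀) = 0 := by linear_combination -e
    rcases mul_eq_zero.1 h with h | h
    · exact hω1 (sub_eq_zero.1 h)
    · exact hcz (sub_eq_zero.1 h)
  have hc' := hΩ.rotation_mem hω0 hRm hc
  obtain ⟨A, hA, hmax, ⟨t, ht⟩, B, hB, hmin, hAB⟩ := exists_isMaxOn_on_line hΩ hd hγ.unit_speed
    hγ.range_eq (γ' := fun t => z₀ + ω * (γ t - z₀))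
    (fun t => (deriv_rotation hd z₀ ω t).differentiableAt)
    (fun t => by rw [(deriv_rotation hd z₀ ω t).deriv, norm_mul, hω, hγ.unit_speed, one_mul])
    (by rw [← hR, ← hγ.range_eq, ← Set.range_comp]; rfl) hc hc' hcc hfocal
    (hfocal.rotation hd hγ.unit_speed hω)
  rcases hp.eq_or_lt with rfl | hp3
  · have hneg : ω = -1 := by
      rw [hωdef, hθ]
      push_cast
      rw [mul_div_cancel_left₀ _ (two_ne_zero), Complex.exp_pi_mul_I]
    rw [hneg] at hmax hmin hAB hc' hRm ht
    exact hexc ⟨rfl, isEllipse_of_central_symmetry hΩ hc hc' hRm hA hB hmax hmin ht hAB⟩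
  -- For p ≥ 3 the angle is below π, so the real part of `ω` exceeds -1.
  · refine not_isMaxOn_of_rotation hω hω1 ?_ hcz hR hA ht hmax
    rw [hωre, ← Real.cos_pi]
    have h3 : (3 : ℝ) ≤ p := by exact_mod_cast hp3
    refine Real.cos_lt_cos_of_nonneg_of_le_pi (by positivity) le_rfl ?_
    rw [hθ, div_lt_iff₀ hp0]
    nlinarith [Real.pi_pos]
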